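/- For $x\in\mathbb F_2^3$ let $Maj_3(x)=1$ if at least two coordinates of $x$ equal $1$, and $Maj_3(x)=0$ otherwise. Let $k\ge 1$, $n=3^k$, and let $Maj_3^{\circ k}\colon \mathbb F_2^n\to\mathbb F_2$ be the $k$-fold composition of $Maj_3$, i.e. $Maj_3^{\circ 1}=Maj_3$ and $Maj_3^{\circ (j+1)}(x)=Maj_3\big(Maj_3^{\circ j}(x^{(1)}),Maj_3^{\circ j}(x^{(2)}),Maj_3^{\circ j}(x^{(3)})\big)$, where $x^{(1)},x^{(2)},x^{(3)}$ are the three consecutive blocks of length $3^j$ of $x$. For $f\colon\mathbb F_2^n\to\mathbb F_2$ and $\delta\in\mathbb R$: * $\mathcal D^{lin,U}_\delta(f)$ is the smallest $d$ for which there are $\alpha_1,\dots,\alpha_d\in\mathbb F_2^n$ and $g\colon\mathbb F_2^d\to\mathbb F_2$ with $\Pr_{x}[f(x)=g(\alpha_1\cdot x,\dots,\alpha_d\cdot x)]\ge 1-\delta$ for uniformly random $x\in\mathbb F_2^n$; * $f^+(x,y)=f(x+y)$, and $\mathcal D^{\rightarrow,U}_\delta(f^+)$ is the smallest $t$ for which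 there are a message function $M\colon\mathbb F_2^n\to\{0,1\}^t$ and an output function $B\colon\{0,1\}^t\times\mathbb F_2^n\to\mathbb F_2$ with $\Pr_{x,y}[f^+(x,y)=B(M(x),y)]\ge 1-\delta$ for independent uniformly random $x,y\in\mathbb F_2^n$. Both quantities are $+\infty$ if no such $d$ (resp. $t$) exists, which happens only for $\delta<0$. **Theorem.** For every $\epsilon\in[0,1]$ and every $\gamma<\frac12-\epsilon$, $$\mathcal D^{lin,U}_{\gamma}\big(Maj_3^{\circ k}\big)\ \ge\ \lfloor\epsilon^2 n\rfloor+1,\qquad\qquad \mathcal D^{\rightarrow,U}_{\frac1n\left(\frac14-\epsilon^2\right)}\big((Maj_3^{\circ k})^+\big)\ \ge\ \epsilon^2 n+1 .$$ In particular, the first bound is $\epsilon^2 n+1$ whenever $\epsilon^2n$ is an integer. -/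

import Mathlib

namespace F2Sketch

/-- The vector space `𝔽₂ⁿ`. -/
abbrev Cube (n : ℕ) : Type := Fin n → ZMod 2

/-- The probability of the event `p` under the uniform distribution on a finite type. -/
noncomputable def uniformProb {α : Type} [Fintype α] (p : α → Prop) [DecidablePred p] : ℝ :=
  ((Finset.univ.filter p).card : ℝ) / (Fintype.card α : ℝ)

/-- The sum (over `𝔽₂`) of the coordinates of `x` selected by `α`. -/
def parity {n : ℕ} (α x : Cube n) : ZMod 2 := ∑ i, α i * x i

/-- There is a deterministic `𝔽₂`-sketch with `d` linear functions whose output, after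
post-processing by `g`, equals `f x` with probability at least `1 - δ` over uniform `x`. -/
def HasUniformSketch {n : ℕ} (f : Cube n → ZMod 2) (δ : ℝ) (d : ℕ) : Prop :=
  ∃ (α : Fin d → Cube n) (g : (Fin d → ZMod 2) → ZMod 2),
    1 - δ ≤ uniformProb (fun x : Cube n => f x = g (fun i => parity (α i) x))

/-- The uniform distributional `𝔽₂`-sketch complexity of `f` with error `δ`: the smallest
dimension of a suitable sketch (`⊤` if there is none, which happens only for `δ < 0`). -/
noncomputable def uniformSketchComplexity {n : ℕ} (f : Cube n → ZMod 2) (δ : ℝ) : ℕ∞ :=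
  ⨅ (d : ℕ) (_ : HasUniformSketch f δ d), (d : ℕ∞)

/-- There is a deterministic one-way protocol (Alice's message `M x` consists of `t` bits, Bob
outputs `B (M x) y`) that computes `F x y` with probability at least `1 - δ` over uniformly
distributed `(x, y)`. -/
def HasUniformOneWayProtocol {m n : ℕ} (F : Cube m → Cube n → ZMod 2) (δ : ℝ) (t : ℕ) : Prop :=
  ∃ (M : Cube m → (Fin t → Bool)) (B : (Fin t → Bool) → Cube n → ZMod 2),
    1 - δ ≤ uniformProb (fun p : Cube m × Cube n => F p.1 p.2 = B (M p.1) p.2)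

/-- The one-way distributional communication complexity of `F` with error `δ` for the uniform
distribution: the smallest number of bits sent in a suitable protocol (`⊤` if there is none,
which happens only for `δ < 0`). -/
noncomputable def uniformOneWayComplexity {m n : ℕ} (F : Cube m → Cube n → ZMod 2) (δ : ℝ) : ℕ∞ :=
  ⨅ (t : ℕ) (_ : HasUniformOneWayProtocol F δ t), (t : ℕ∞)

/-- The XOR-function `f⁺(x, y) = f(x + y)`. -/
def xorFunction {n : ℕ} (f : Cube n → ZMod 2) (x y : Cube n) : ZMod 2 := f (x + y)

/-- The majority function: `1` if and only if the Hamming weight of `x` exceeds `n / 2`. -/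
def maj (n : ℕ) (x : Cube n) : ZMod 2 := if n < 2 * hammingNorm x then 1 else 0

/-- Composition `f ∘ g`: `f` applied to the values of `g` on `n` consecutive blocks of length `m`
(`finProdFinEquiv (i, j)` is the position `j + m * i`). -/
def comp {n m : ℕ} (f : Cube n → ZMod 2) (g : Cube m → ZMod 2) (x : Cube (n * m)) : ZMod 2 :=
  f (fun i => g (fun j => x (finProdFinEquiv (i, j))))

/-- Recursive majority: the `k`-fold composition of `maj 3`, on `3 ^ k` variables (for `k = 0`,
the empty composition, it is the identity on one bit). -/
def recMaj : (k : ℕ) → Cube (3 ^ k) → ZMod 2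
  | 0, x => x 0
  | k + 1, x => comp (maj 3) (recMaj k) (fun i => x (Fin.cast (pow_succ' 3 k).symm i))

end F2Sketch

namespace F2Sketch

open Finset

/-! Everything rests on one property of the Fourier spectrum of recursive majority,
`exists_recMaj_spectrum`: a subspace `A` carries Fourier weight at most `dim A / n`. It is proved by
induction on `k`. The squared spectrum of a threefold majority is a quarter of the sum of three
copies of the inner one, each living on one block, and of their product measure. Bounding these by
slices and projections of `A` (`sum_tripleCoeff_sq_le`) closes the induction.

For a sketch, the output depends only on parities in a space of dimension at most `d`, so by
Cauchy-Schwarz its correlation with `f` is at most the square root of the weight there, hence at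
most `√(d / n)`.

For a protocol, a message tells Bob that `x` lies in a fibre `X`, and his advantage is governed by
the Fourier weight of `f` damped by the squared normalized character sums of `X`. Undamped
characters, those above the threshold `1 - 1/n`, span a space whose dimension is about `log (2ⁿ /
|X|)` at most (`card_mul_two_pow_largeSpan_le`), on average at most `t + 1`. The subspace bound then
shows that part of the weight is damped, which forces error. For `n = 3` these estimates are too
lossy; a bound on individual coefficients replaces them. -/

/-- The character `(-1)^a` of `𝔽₂`. -/
def sgn (a : ZMod 2) : ℝ := if a = 0 then 1 else -1

@[simp] lemma sgn_zero : sgn 0 = 1 := by simp [sgn]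

@[simp] lemma sgn_one : sgn 1 = -1 := by simp [sgn]

lemma zmod_two_cases (a : ZMod 2) : a = 0 ∨ a = 1 := by
  revert a; decide

lemma sgn_add (a b : ZMod 2) : sgn (a + b) = sgn a * sgn b := by
  have h : (1 : ZMod 2) + 1 = 0 := by decide
  rcases zmod_two_cases a with rfl | rfl <;> rcases zmod_two_cases b with rfl | rfl <;> simp [h]

lemma sgn_mul_self (a : ZMod 2) : sgn a * sgn a = 1 := by
  rcases zmod_two_cases a with rfl | rfl <;> simp

lemma sgn_sq (a : ZMod 2) : sgn a ^ 2 = 1 := by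
  rw [sq, sgn_mul_self]

lemma abs_sgn (a : ZMod 2) : |sgn a| = 1 := by
  rcases zmod_two_cases a with rfl | rfl <;> simp

lemma sgn_sum {ι : Type*} (s : Finset ι) (f : ι → ZMod 2) :
    sgn (∑ i ∈ s, f i) = ∏ i ∈ s, sgn (f i) := by
  classical
  induction s using Finset.induction_on with
  | empty => simp
  | insert a s ha ih => rw [sum_insert ha, prod_insert ha, sgn_add, ih]

lemma ite_eq_sgn (a b : ZMod 2) : (if a = b then (1 : ℝ) else 0) = (1 + sgn a * sgn b) / 2 := by
  rcases zmod_two_cases a with rfl | rfl <;> rcases zmod_two_cases b with rfl | rfl <;> simp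

/-! ### Characters of the cube and Plancherel -/

variable {n : ℕ}

lemma parity_comm (S x : Cube n) : parity S x = parity x S := by
  simp [parity, mul_comm]

lemma parity_add_left (S T x : Cube n) : parity (S + T) x = parity S x + parity T x := by
  simp [parity, add_mul, sum_add_distrib]

lemma parity_add_right (S x y : Cube n) : parity S (x + y) = parity S x + parity S y := by
  simp [parity, mul_add, sum_add_distrib]

@[simp] lemma parity_zero_left (x : Cube n) : parity 0 x = 0 := by
  simp [parity]

/-- The Fourier character of `𝔽₂ⁿ` with index `S`. -/
def chi (S x : Cube n) : ℝ := sgn (parity S x)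

lemma chi_comm (S x : Cube n) : chi S x = chi x S := by
  rw [chi, parity_comm, chi]

lemma chi_add_left (S T x : Cube n) : chi (S + T) x = chi S x * chi T x := by
  rw [chi, parity_add_left, sgn_add, chi, chi]

lemma chi_add_right (S x y : Cube n) : chi S (x + y) = chi S x * chi S y := by
  rw [chi, parity_add_right, sgn_add, chi, chi]

@[simp] lemma chi_zero_left (x : Cube n) : chi 0 x = 1 := by
  simp [chi]

lemma abs_chi (S x : Cube n) : |chi S x| = 1 := abs_sgn _

lemma card_cube (n : ℕ) : Fintype.card (Cube n) = 2 ^ n := by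
  simp [Cube, ZMod.card]

/-- Translation by `v` preserves the sum but flips the sign of every term. -/
lemma sum_mul_chi_eq_zero {h : Cube n → ℝ} {S v : Cube n} (hh : ∀ x, h (x + v) = h x)
    (hv : parity S v = 1) : ∑ x, h x * chi S x = 0 := by
  have h1 : ∑ x, h (x + v) * chi S (x + v) = ∑ x, h x * chi S x :=
    Equiv.sum_comp (Equiv.addRight v) (fun x => h x * chi S x)
  have h2 : ∀ x, h (x + v) * chi S (x + v) = -(h x * chi S x) := fun x => by
    rw [hh, chi_add_right, chi, chi, hv, sgn_one]; ring
  simp only [h2, sum_neg_distrib] at h1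
  linarith

lemma cube_add_eq_zero_iff (S T : Cube n) : S + T = 0 ↔ S = T := by
  constructor
  · intro h
    funext i
    have := congrFun h i
    simp only [Pi.add_apply, Pi.zero_apply] at this
    revert this
    generalize S i = a
    generalize T i = b
    revert a b
    decide
  · rintro rfl
    funext i
    simp only [Pi.add_apply, Pi.zero_apply]
    generalize S i = a
    revert a
    decide

lemma sum_chi (S : Cube n) : ∑ x, chi S x = if S = 0 then (2 : ℝ) ^ n else 0 := by
  split_ifs with h
  · subst h
    simp
  · obtain ⟨i, hi⟩ := Function.ne_iff.mp h
    have hi : S i = 1 := (zmod_two_cases (S i)).resolve_left hi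
    have := sum_mul_chi_eq_zero (h := fun _ => 1) (S := S) (v := Pi.single i 1)
      (fun _ => rfl) (by simp [parity, Pi.single_apply, hi])
    simpa using this

lemma sum_chi_mul_chi (S T : Cube n) :
    ∑ x, chi S x * chi T x = if S = T then (2 : ℝ) ^ n else 0 := by
  simp only [← chi_add_left, sum_chi, cube_add_eq_zero_iff]

/-- Plancherel's identity. -/
lemma sum_sq_sum_mul_chi (w : Cube n → ℝ) :
    ∑ x, (∑ S, w S * chi S x) ^ 2 = 2 ^ n * ∑ S, w S ^ 2 := by
  calc ∑ x, (∑ S, w S * chi S x) ^ 2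
      = ∑ x, ∑ S, ∑ T, w S * w T * (chi S x * chi T x) := by
        refine sum_congr rfl fun x _ => ?_
        rw [sq, sum_mul_sum]
        exact sum_congr rfl fun S _ => sum_congr rfl fun T _ => by ring
    _ = ∑ S, ∑ T, w S * w T * ∑ x, chi S x * chi T x := by
        rw [sum_comm]
        refine sum_congr rfl fun S _ => ?_
        rw [sum_comm]
        exact sum_congr rfl fun T _ => by rw [mul_sum]
    _ = 2 ^ n * ∑ S, w S ^ 2 := by
        simp only [sum_chi_mul_chi, mul_ite, mul_zero, sum_ite_eq, mem_univ, if_true, mul_sum]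
        exact sum_congr rfl fun S _ => by ring

/-- The unnormalized Fourier coefficient of the indicator function of `X`. -/
def charSum (X : Finset (Cube n)) (S : Cube n) : ℝ := ∑ x ∈ X, chi S x

@[simp] lemma charSum_zero (X : Finset (Cube n)) : charSum X 0 = X.card := by
  simp [charSum]

lemma sum_charSum_sq (X : Finset (Cube n)) : ∑ S, charSum X S ^ 2 = 2 ^ n * X.card := by
  have := sum_sq_sum_mul_chi (fun x : Cube n => if x ∈ X then (1 : ℝ) else 0)
  simp only [ite_mul, one_mul, zero_mul, sum_ite_mem, univ_inter, ite_pow, one_pow, ne_eq,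
    OfNat.ofNat_ne_zero, not_false_eq_true, zero_pow, sum_const, nsmul_eq_mul, mul_one] at this
  rw [← this]
  exact sum_congr rfl fun S _ => by simp only [charSum, chi_comm S]

lemma abs_charSum_le (X : Finset (Cube n)) (S : Cube n) : |charSum X S| ≤ X.card := by
  refine (abs_sum_le_sum_abs _ _).trans ?_
  simp [abs_chi]

lemma sum_sq_sum_translate {F c : Cube n → ℝ} (hF : ∀ x, F x = ∑ S, c S * chi S x)
    (X : Finset (Cube n)) :
    ∑ y, (∑ x ∈ X, F (x + y)) ^ 2 = 2 ^ n * ∑ S, c S ^ 2 * charSum X S ^ 2 := by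
  simp only [← mul_pow]
  rw [← sum_sq_sum_mul_chi]
  refine sum_congr rfl fun y _ => ?_
  congr 1
  simp only [hF, chi_add_right, charSum]
  rw [sum_comm]
  refine sum_congr rfl fun S _ => ?_
  rw [mul_sum, sum_mul]
  exact sum_congr rfl fun x _ => by ring

lemma uniformProb_eq {α : Type} [Fintype α] [Nonempty α] (u v : α → ZMod 2) :
    uniformProb (fun a => u a = v a) =
      1 / 2 + (∑ a, sgn (u a) * sgn (v a)) / (2 * Fintype.card α) := by
  have h0 : (Fintype.card α : ℝ) ≠ 0 := by exact_mod_cast Fintype.card_ne_zero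
  have h : ((univ.filter fun a => u a = v a).card : ℝ) =
      ∑ a, (1 + sgn (u a) * sgn (v a)) / 2 := by
    rw [card_filter]
    push_cast
    exact sum_congr rfl fun a _ => ite_eq_sgn _ _
  rw [uniformProb, h, ← sum_div, sum_add_distrib]
  simp
  field_simp

/-- The Fourier weight, with respect to the coefficients `c`, on the subspace `A`. -/
noncomputable def weight (c : Cube n → ℝ) (A : Submodule (ZMod 2) (Cube n)) : ℝ :=
  by classical exact ∑ S, if S ∈ A then c S ^ 2 else 0

open Classical in
lemma weight_eq (c : Cube n → ℝ) (A : Submodule (ZMod 2) (Cube n)) :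
    weight c A = ∑ S, if S ∈ A then c S ^ 2 else 0 := rfl

lemma weight_top (c : Cube n → ℝ) : weight c ⊤ = ∑ S, c S ^ 2 := by
  simp [weight_eq]

/-! ### Fourier weight of a threefold majority composition on subspaces -/

lemma sum_fun_prod {ι V : Type*} [Fintype ι] [DecidableEq ι] [Fintype V] (f : ι → V → ℝ) :
    ∑ T : ι → V, ∏ j, f j (T j) = ∏ j, ∑ v, f j v := by
  rw [prod_univ_sum, Fintype.piFinset_univ]

section Triple

variable {V : Type*} [AddCommGroup V]

/-- `c v` if `j = i`, and the indicator of `v = 0` otherwise. -/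
noncomputable def blockFactor (c : V → ℝ) (i j : Fin 3) (v : V) : ℝ :=
  by classical exact if j = i then c v else if v = 0 then 1 else 0

open Classical in
lemma blockFactor_eq (c : V → ℝ) (i j : Fin 3) (v : V) :
    blockFactor c i j v = if j = i then c v else if v = 0 then 1 else 0 := rfl

/-- The Fourier coefficients of `maj 3 ∘ g` in terms of those of `g`. -/
noncomputable def tripleCoeff (c : V → ℝ) (T : Fin 3 → V) : ℝ :=
  (∑ i, ∏ j, blockFactor c i j (T j) - ∏ j, c (T j)) / 2

lemma tripleCoeff_zero {c : V → ℝ} (h0 : c 0 = 0) : tripleCoeff c 0 = 0 := by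
  simp [tripleCoeff, blockFactor_eq, h0]

/-- Since `c 0 = 0`, the four products in `tripleCoeff` have pairwise disjoint supports, so no cross
terms survive squaring. -/
lemma tripleCoeff_sq {c : V → ℝ} (h0 : c 0 = 0) (T : Fin 3 → V) :
    tripleCoeff c T ^ 2 =
      (∑ i, ∏ j, blockFactor (fun v => c v ^ 2) i j (T j) + ∏ j, c (T j) ^ 2) / 4 := by
  simp only [tripleCoeff, blockFactor_eq, Fin.sum_univ_three, Fin.prod_univ_three, Fin.isValue]
  by_cases h1 : T 0 = 0 <;> by_cases h2 : T 1 = 0 <;> by_cases h3 : T 2 = 0 <;>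
    simp [h0, h1, h2, h3] <;> ring

variable [Module (ZMod 2) V] [Fintype V]

lemma natCard_submodule (A : Submodule (ZMod 2) V) :
    Nat.card A = 2 ^ Module.finrank (ZMod 2) A := by
  rw [Module.natCard_eq_pow_finrank (K := ZMod 2), Nat.card_zmod]

/-- The part of a subspace of `V³` that is supported on the `i`-th block. -/
abbrev slice (A : Submodule (ZMod 2) (Fin 3 → V)) (i : Fin 3) : Submodule (ZMod 2) V :=
  A.comap (LinearMap.single (ZMod 2) (fun _ => V) i)

/-- The projection of a subspace of `V³` to the `i`-th block. -/
abbrev shadow (A : Submodule (ZMod 2) (Fin 3 → V)) (i : Fin 3) : Submodule (ZMod 2) V :=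
  A.map (LinearMap.proj i)

lemma finrank_shadow_add_le (A : Submodule (ZMod 2) (Fin 3 → V)) {i j l : Fin 3}
    (hij : i ≠ j) (hil : i ≠ l) (hjl : j ≠ l) :
    Module.finrank (ZMod 2) (shadow A i) + Module.finrank (ZMod 2) (slice A j) +
      Module.finrank (ZMod 2) (slice A l) ≤ Module.finrank (ZMod 2) A := by
  have hlift : ∀ b : shadow A i, ∃ a : A, (a : Fin 3 → V) i = b := by
    rintro ⟨b, a, ha, rfl⟩
    exact ⟨⟨a, ha⟩, rfl⟩
  choose lift hl using hlift
  -- The lift need not be linear: injectivity and a count of elements suffice. Coordinate `i`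
  -- recovers `b`, after which coordinates `j` and `l` recover the slice elements.
  let φ : (shadow A i × slice A j) × slice A l → A := fun p =>
    lift p.1.1 + ⟨_, p.1.2.2⟩ + ⟨_, p.2.2⟩
  have hφ : ∀ p, ((φ p : A) : Fin 3 → V) =
      (lift p.1.1 : Fin 3 → V) + Pi.single j (p.1.2 : V) + Pi.single l (p.2 : V) :=
    fun p => rfl
  have hinj : Function.Injective φ := by
    rintro ⟨⟨b, u⟩, v⟩ ⟨⟨b', u'⟩, v'⟩ h
    have h' := congrArg (Subtype.val) h
    rw [hφ, hφ] at h'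
    have h1 := congrFun h' i
    simp only [Pi.add_apply, Pi.single_apply, if_neg hij, if_neg hil, hl, add_zero] at h1
    have h1 : b = b' := Subtype.ext h1
    subst h1
    have h2 := congrFun h' j
    have h3 := congrFun h' l
    simp only [Pi.add_apply, Pi.single_apply, if_neg hjl, if_neg hjl.symm, add_zero, if_true,
      add_left_cancel_iff] at h2 h3
    rw [Subtype.ext h2, Subtype.ext h3]
  have := Nat.card_le_card_of_injective φ hinj
  rw [Nat.card_prod, Nat.card_prod, natCard_submodule, natCard_submodule, natCard_submodule,
    natCard_submodule, ← pow_add, ← pow_add] at this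
  exact (Nat.pow_le_pow_iff_right one_lt_two).mp this

lemma finrank_slice_le_shadow (A : Submodule (ZMod 2) (Fin 3 → V)) (i : Fin 3) :
    Module.finrank (ZMod 2) (slice A i) ≤ Module.finrank (ZMod 2) (shadow A i) :=
  Submodule.finrank_mono fun v hv => ⟨Pi.single i v, hv, by simp⟩

open Classical in
lemma sum_blockFactor_le {w : V → ℝ} {m : ℝ}
    (hW : ∀ A : Submodule (ZMod 2) V,
      ∑ v, (if v ∈ A then w v else 0) ≤ Module.finrank (ZMod 2) A / m)
    (A : Submodule (ZMod 2) (Fin 3 → V)) (i : Fin 3) :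
    ∑ T, (if T ∈ A then ∏ j, blockFactor w i j (T j) else 0) ≤
      Module.finrank (ZMod 2) (slice A i) / m := by
  refine le_of_eq_of_le ?_ (hW (slice A i))
  symm
  refine sum_of_injOn (fun v => Pi.single i v) 
    ((Pi.single_injective (M := fun _ => V) i).injOn) (by simp) ?_ ?_
  · intro T _ hT
    rw [ite_eq_right_iff]
    intro _
    by_contra hne
    refine hT ⟨T i, by simp, ?_⟩
    funext j
    by_cases hj : j = i
    · subst hj; simp
    · have := prod_ne_zero_iff.mp hne j (mem_univ j)
      rw [blockFactor_eq, if_neg hj] at this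
      simpa [hj, eq_comm] using this
  · intro v _
    have : ∏ j, blockFactor w i j ((Pi.single i v : Fin 3 → V) j) = w v := by
      rw [prod_eq_single i]
      · simp [blockFactor_eq]
      · intro j _ hj
        simp [blockFactor_eq, hj]
      · simp
    rw [this]
    rfl

-- Membership in `A` is relaxed to a condition on block `i` alone; the other two blocks then
-- contribute total mass at most 1 each.
open Classical in
lemma sum_prod_le_shadow {w : V → ℝ} (hw : ∀ v, 0 ≤ w v) (hw1 : ∑ v, w v ≤ 1) {m : ℝ}
    (hW : ∀ A : Submodule (ZMod 2) V,
      ∑ v, (if v ∈ A then w v else 0) ≤ Module.finrank (ZMod 2) A / m)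
    (A : Submodule (ZMod 2) (Fin 3 → V)) (i : Fin 3) :
    ∑ T, (if T ∈ A then ∏ j, w (T j) else 0) ≤
      Module.finrank (ZMod 2) (shadow A i) / m := by
  refine le_trans ?_ (hW (shadow A i))
  let f : Fin 3 → V → ℝ := fun j v => if j = i then (if v ∈ shadow A i then w v else 0) else w v
  have hf : ∀ j v, 0 ≤ f j v := fun j v => by
    dsimp only [f]
    split_ifs <;> simp [hw]
  calc ∑ T, (if T ∈ A then ∏ j, w (T j) else 0) ≤ ∑ T : Fin 3 → V, ∏ j, f j (T j) := by
        refine sum_le_sum fun T _ => ?_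
        split_ifs with hT
        · refine le_of_eq (prod_congr rfl fun j _ => ?_)
          dsimp only [f]
          split_ifs with h1 h2
          · rfl
          · subst h1
            exact absurd ⟨T, hT, rfl⟩ h2
          · rfl
        · exact prod_nonneg fun j _ => hf _ _
    _ = ∏ j, ∑ v, f j v := sum_fun_prod f
    _ = (∑ v, f i v) * ∏ j ∈ univ.erase i, ∑ v, f j v := (mul_prod_erase _ _ (mem_univ i)).symm
    _ ≤ (∑ v, f i v) * 1 := by
        refine mul_le_mul_of_nonneg_left ?_ (sum_nonneg fun v _ => hf _ _)
        refine prod_le_one (fun j _ => sum_nonneg fun v _ => hf _ _) fun j hj => ?_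
        simpa [f, ne_of_mem_erase hj] using hw1
    _ = _ := by simp [f]

open Classical in
lemma sum_tripleCoeff_sq_le {c : V → ℝ} (h0 : c 0 = 0) (h1 : ∑ v, c v ^ 2 ≤ 1) {m : ℝ}
    (hm : 0 < m)
    (hW : ∀ A : Submodule (ZMod 2) V,
      ∑ v, (if v ∈ A then c v ^ 2 else 0) ≤ Module.finrank (ZMod 2) A / m)
    (A : Submodule (ZMod 2) (Fin 3 → V)) :
    ∑ T, (if T ∈ A then tripleCoeff c T ^ 2 else 0) ≤
      Module.finrank (ZMod 2) A / (3 * m) := by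
  have hsplit : ∑ T, (if T ∈ A then tripleCoeff c T ^ 2 else 0) =
      (∑ i, ∑ T, (if T ∈ A then ∏ j, blockFactor (fun v => c v ^ 2) i j (T j) else 0) +
        ∑ T, (if T ∈ A then ∏ j, c (T j) ^ 2 else 0)) / 4 := by
    rw [sum_comm, ← sum_add_distrib, sum_div]
    refine sum_congr rfl fun T _ => ?_
    split_ifs
    · exact tripleCoeff_sq h0 T
    · simp
  have ha := sum_blockFactor_le hW A
  have hb := sum_prod_le_shadow (fun v => sq_nonneg (c v)) h1 hW A
  have hd : ∀ i j l : Fin 3, i ≠ j → i ≠ l → j ≠ l →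
      (Module.finrank (ZMod 2) (shadow A i) : ℝ) / m ≤ Module.finrank (ZMod 2) A / m -
        Module.finrank (ZMod 2) (slice A j) / m - Module.finrank (ZMod 2) (slice A l) / m := by
    intro i j l hij hil hjl
    have : (Module.finrank (ZMod 2) (shadow A i) : ℝ) + Module.finrank (ZMod 2) (slice A j) +
      Module.finrank (ZMod 2) (slice A l) ≤ Module.finrank (ZMod 2) A := by
      exact_mod_cast finrank_shadow_add_le A hij hil hjl
    rw [← sub_div, ← sub_div]
    gcongr
    linarith
  have hs : (Module.finrank (ZMod 2) (slice A 0) : ℝ) / m ≤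
      Module.finrank (ZMod 2) (shadow A 0) / m := by
    gcongr
    exact finrank_slice_le_shadow A 0
  have hD : (Module.finrank (ZMod 2) A : ℝ) / (3 * m) = Module.finrank (ZMod 2) A / m / 3 := by
    field_simp
  -- In units of `1/m`, let `D` be the dimension of `A`, `s` the sum of the slice dimensions and `p`
  -- the product term. Averaging the three shadow bounds gives `p ≤ D - 2s/3`, and slice 0 being
  -- inside shadow 0 gives `s ≤ D`. Hence `(s + p)/4 ≤ (D + s/3)/4 ≤ D/3`.
  rw [hsplit, Fin.sum_univ_three, hD]
  linarith [hs, ha 0, ha 1, ha 2, hb 0, hb 1, hb 2, hd 0 1 2 (by decide) (by decide) (by decide),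
    hd 1 2 0 (by decide) (by decide) (by decide), hd 2 0 1 (by decide) (by decide) (by decide)]

end Triple

/-! ### The Fourier spectrum of recursive majority -/

lemma sgn_maj_three (y : Cube 3) :
    sgn (maj 3 y) = (∑ i, sgn (y i) - ∏ i, sgn (y i)) / 2 := by
  have h : ∀ y : Cube 3, maj 3 y = y 0 * y 1 + y 0 * y 2 + y 1 * y 2 := by decide
  have h2 : (1 : ZMod 2) + 1 = 0 := by decide
  rw [h, Fin.sum_univ_three, Fin.prod_univ_three]
  rcases zmod_two_cases (y 0) with h0 | h0 <;> rcases zmod_two_cases (y 1) with h1 | h1 <;>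
    rcases zmod_two_cases (y 2) with h3 | h3 <;> simp [h0, h1, h3, h2] <;> norm_num

/-- The position of a coordinate of one of the three blocks. -/
def blockIndex (k : ℕ) : Fin 3 × Fin (3 ^ k) ≃ Fin (3 ^ (k + 1)) :=
  finProdFinEquiv.trans (finCongr (pow_succ' 3 k).symm)

/-- The decomposition of a vector into three consecutive blocks. -/
def blocks (k : ℕ) : Cube (3 ^ (k + 1)) ≃ₗ[ZMod 2] (Fin 3 → Cube (3 ^ k)) :=
  (LinearEquiv.funCongrLeft (ZMod 2) (ZMod 2) (blockIndex k)).trans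
    (LinearEquiv.curry (ZMod 2) (ZMod 2) (Fin 3) (Fin (3 ^ k)))

lemma recMaj_succ (k : ℕ) (x : Cube (3 ^ (k + 1))) :
    recMaj (k + 1) x = maj 3 fun i => recMaj k (blocks k x i) := rfl

lemma chi_blocks (k : ℕ) (S x : Cube (3 ^ (k + 1))) :
    chi S x = ∏ i, chi (blocks k S i) (blocks k x i) := by
  simp only [chi, ← sgn_sum, parity]
  rw [← Equiv.sum_comp (blockIndex k), Fintype.sum_prod_type]
  rfl

lemma sum_tripleCoeff_mul_prod_chi {n : ℕ} (c : Cube n → ℝ) (y : Fin 3 → Cube n) :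
    ∑ T : Fin 3 → Cube n, tripleCoeff c T * ∏ i, chi (T i) (y i) =
      (∑ i, ∑ S, c S * chi S (y i) - ∏ i, ∑ S, c S * chi S (y i)) / 2 := by
  have h1 : ∀ i, ∑ T : Fin 3 → Cube n, ∏ j, blockFactor c i j (T j) * chi (T j) (y j) =
      ∑ S, c S * chi S (y i) := by
    intro i
    rw [sum_fun_prod (fun j v => blockFactor c i j v * chi v (y j)), prod_eq_single i]
    · simp [blockFactor_eq]
    · intro j _ hj
      simp [blockFactor_eq, hj]
    · simp
  rw [← sum_fun_prod (fun j v => c v * chi v (y j))]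
  simp only [← h1]
  rw [sum_comm, ← sum_sub_distrib, sum_div]
  refine sum_congr rfl fun T _ => ?_
  simp only [tripleCoeff, prod_mul_distrib, ← sum_mul]
  ring

theorem exists_recMaj_spectrum (k : ℕ) :
    ∃ c : Cube (3 ^ k) → ℝ, c 0 = 0 ∧ (∀ x, sgn (recMaj k x) = ∑ S, c S * chi S x) ∧
      ∀ A : Submodule (ZMod 2) (Cube (3 ^ k)),
        weight c A ≤ Module.finrank (ZMod 2) A / (3 : ℝ) ^ k := by
  classical
  induction k with
  | zero =>
    refine ⟨fun S => if S = 1 then 1 else 0, if_neg (by decide), fun x => ?_, fun A => ?_⟩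
    · have : parity (1 : Cube (3 ^ 0)) x = x 0 := by
        simp only [parity, Pi.one_apply, one_mul]
        exact Fin.sum_univ_one x
      simp [recMaj, chi, this]
    · by_cases h : (1 : Cube (3 ^ 0)) ∈ A
      · have hA : A ≠ ⊥ := fun hA => by
          rw [hA, Submodule.mem_bot] at h
          exact absurd h (by decide)
        have : 1 ≤ Module.finrank (ZMod 2) A := Submodule.one_le_finrank_iff.mpr hA
        have : (1 : ℝ) ≤ Module.finrank (ZMod 2) A := by exact_mod_cast this
        rw [weight_eq, sum_eq_single 1]
        · simpa [h] using this
        · intro S _ hS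
          simp [hS]
        · simp
      · have : ∀ S, (if S ∈ A then (if S = (1 : Cube (3 ^ 0)) then (1 : ℝ) else 0) ^ 2
            else 0) = 0 := by
          intro S
          split_ifs with h1 h2
          · exact absurd (h2 ▸ h1) h
          · simp
          · rfl
        rw [weight_eq, sum_eq_zero fun S _ => this S]
        positivity
  | succ k ih =>
    obtain ⟨c, h0, hF, hW⟩ := ih
    have hm : (0 : ℝ) < 3 ^ k := by positivity
    -- The subspace bound for the whole space already contains the needed half of Parseval.
    have h1 : ∑ v, c v ^ 2 ≤ 1 := by
      rw [← weight_top]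
      refine (hW ⊤).trans (le_of_eq ?_)
      rw [finrank_top, Module.finrank_fin_fun]
      push_cast
      exact div_self hm.ne'
    refine ⟨fun S => tripleCoeff c (blocks k S), ?_, fun x => ?_, fun A => ?_⟩
    · dsimp only
      rw [map_zero]
      exact tripleCoeff_zero h0
    · simp only [chi_blocks]
      refine Eq.trans ?_ (Equiv.sum_comp (blocks k).toEquiv
        (fun T => tripleCoeff c T * ∏ i, chi (T i) (blocks k x i))).symm
      rw [sum_tripleCoeff_mul_prod_chi, recMaj_succ, sgn_maj_three]
      simp only [hF]
    · have := sum_tripleCoeff_sq_le h0 h1 hm hW (A.map (blocks k : _ →ₗ[ZMod 2] _))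
      rw [LinearEquiv.finrank_map_eq, ← pow_succ'] at this
      refine le_of_eq_of_le ?_ this
      rw [weight_eq, ← Equiv.sum_comp (blocks k).toEquiv]
      refine sum_congr rfl fun S _ => ?_
      simp

/-! ### Sketches -/

/-- A linear functional separating `S` from `A` is the parity against its vector of values on the
standard basis. -/
lemma exists_parity_eq_one {A : Submodule (ZMod 2) (Cube n)} {S : Cube n} (hS : S ∉ A) :
    ∃ v : Cube n, parity S v = 1 ∧ ∀ T ∈ A, parity T v = 0 := by
  obtain ⟨φ, hφ, hA⟩ := Submodule.exists_le_ker_of_notMem hS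
  have hv : ∀ T : Cube n, parity T (fun i => φ (Pi.single i 1)) = φ T := by
    intro T
    rw [LinearMap.pi_apply_eq_sum_univ φ T]
    simp only [parity, smul_eq_mul]
    refine sum_congr rfl fun i _ => ?_
    congr 2
    funext j
    simp [Pi.single_apply, eq_comm]
  refine ⟨fun i => φ (Pi.single i 1), ?_, fun T hT => ?_⟩
  · rw [hv]
    exact (zmod_two_cases _).resolve_left hφ
  · rw [hv]
    exact hA hT

lemma sq_sum_mul_le_weight {F c : Cube n → ℝ} (hF : ∀ x, F x = ∑ S, c S * chi S x)
    (A : Submodule (ZMod 2) (Cube n)) {h : Cube n → ℝ} (h1 : ∀ x, h x ^ 2 = 1)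
    (hA : ∀ v, (∀ T ∈ A, parity T v = 0) → ∀ x, h (x + v) = h x) :
    (∑ x, F x * h x) ^ 2 ≤ weight c A * (2 ^ n) ^ 2 := by
  classical
  -- Characters outside `A` are orthogonal to `h`, so `F` may be projected to `A` before
  -- Cauchy-Schwarz.
  have hP : ∑ x, F x * h x = ∑ x, (∑ S, (if S ∈ A then c S else 0) * chi S x) * h x := by
    simp only [hF, sum_mul]
    rw [sum_comm, sum_comm (s := univ (α := Cube n)) (t := univ (α := Cube n))
      (f := fun x S => (if S ∈ A then c S else 0) * chi S x * h x)]
    refine sum_congr rfl fun S _ => ?_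
    split_ifs with hS
    · rfl
    · obtain ⟨v, hv, hvA⟩ := exists_parity_eq_one hS
      have := sum_mul_chi_eq_zero (hA v hvA) hv
      calc ∑ x, c S * chi S x * h x = c S * ∑ x, h x * chi S x := by
            rw [mul_sum]
            exact sum_congr rfl fun x _ => by ring
        _ = ∑ x, 0 * chi S x * h x := by rw [this]; simp
  rw [hP]
  refine (sum_mul_sq_le_sq_mul_sq _ _ _).trans (le_of_eq ?_)
  rw [sum_sq_sum_mul_chi, weight_eq]
  simp only [h1, ite_pow, ne_eq, OfNat.ofNat_ne_zero, not_false_eq_true, zero_pow, sum_const,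
    card_univ, card_cube, nsmul_eq_mul, mul_one]
  push_cast
  ring

theorem uniformProb_sketch_le {f : Cube n → ZMod 2} {c : Cube n → ℝ}
    (hF : ∀ x, sgn (f x) = ∑ S, c S * chi S x) {d : ℕ} (α : Fin d → Cube n)
    (g : (Fin d → ZMod 2) → ZMod 2) {r : ℝ} (hr : 0 ≤ r)
    (hW : weight c (Submodule.span (ZMod 2) (Set.range α)) ≤ r ^ 2) :
    uniformProb (fun x : Cube n => f x = g (fun i => parity (α i) x)) ≤ 1 / 2 + r / 2 := by
  have hN : (0 : ℝ) < 2 ^ n := by positivity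
  have h := sq_sum_mul_le_weight hF (Submodule.span (ZMod 2) (Set.range α))
    (h := fun x => sgn (g fun i => parity (α i) x)) (fun x => sgn_sq _) (fun v hv x => by
      have : ∀ i, parity (α i) v = 0 := fun i => hv _ (Submodule.subset_span ⟨i, rfl⟩)
      simp [parity_add_right, this])
  have h2 := abs_le_of_sq_le_sq (h.trans ((mul_le_mul_of_nonneg_right hW (by positivity)).trans
    (mul_pow r _ 2).ge)) (by positivity)
  rw [uniformProb_eq, card_cube]
  push_cast
  have : (∑ x, sgn (f x) * sgn (g fun i => parity (α i) x)) / (2 * 2 ^ n) ≤ r / 2 := by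
    rw [div_le_div_iff₀ (by positivity) two_pos]
    linarith [le_of_abs_le h2]
  linarith

lemma finrank_span_range_le {d : ℕ} (α : Fin d → Cube n) :
    Module.finrank (ZMod 2) (Submodule.span (ZMod 2) (Set.range α)) ≤ d := by
  simpa [Set.finrank] using finrank_range_le_card (R := ZMod 2) α

/-! ### One-way protocols -/

/-- The weight of the Fourier coefficients of `F` after averaging over translates by `X`. -/
noncomputable def smoothWeight (c : Cube n → ℝ) (X : Finset (Cube n)) : ℝ :=
  ∑ S, c S ^ 2 * charSum X S ^ 2

/-- The set of inputs on which the message `m` is sent. -/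
def msgFiber {μ : Type*} [DecidableEq μ] (M : Cube n → μ) (m : μ) : Finset (Cube n) :=
  univ.filter fun x => M x = m

section Fiber

variable {μ : Type*} [Fintype μ] [DecidableEq μ] (M : Cube n → μ)

lemma sum_card_msgFiber : ∑ m, ((msgFiber M m).card : ℝ) = 2 ^ n := by
  have := card_eq_sum_card_fiberwise (f := M) (s := univ) (t := univ) (by simp)
  rw [card_univ, card_cube] at this
  exact_mod_cast this.symm

end Fiber

/-- AM-GM, replacing absolute values by squares that Plancherel can evaluate. For `a = 0`, the case
of an empty fibre, both sides vanish. -/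
lemma abs_le_add_sq_div {a v : ℝ} (ha : |v| ≤ a) : |v| ≤ (a + v ^ 2 / a) / 2 := by
  rcases ((abs_nonneg v).trans ha).eq_or_lt with h | h
  · subst h
    simpa using ha
  · rw [← sq_abs v, le_div_iff₀ two_pos, ← sub_nonneg]
    have : a + |v| ^ 2 / a - |v| * 2 = (a - |v|) ^ 2 / a := by
      field_simp
      ring
    rw [this]
    positivity

/-- Bob's correlation on a fibre `X` is at most the sum over `y` of `|∑ x ∈ X, sgn (f (x + y))|`.
The linear half of the AM-GM bound sums to the constant `3/4`, the quadratic half to the smoothed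
weights. -/
theorem uniformProb_protocol_le {f : Cube n → ZMod 2} {c : Cube n → ℝ}
    (hF : ∀ x, sgn (f x) = ∑ S, c S * chi S x) {μ : Type*} [Fintype μ] [DecidableEq μ]
    (M : Cube n → μ) (B : μ → Cube n → ZMod 2) :
    uniformProb (fun p : Cube n × Cube n => xorFunction f p.1 p.2 = B (M p.1) p.2) ≤
      3 / 4 + (∑ m, smoothWeight c (msgFiber M m) / (msgFiber M m).card) / (4 * 2 ^ n) := by
  have hN : (0 : ℝ) < 2 ^ n := by positivity
  have hcorr : ∑ p : Cube n × Cube n, sgn (xorFunction f p.1 p.2) * sgn (B (M p.1) p.2) =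
      ∑ m, ∑ y, sgn (B m y) * ∑ x ∈ msgFiber M m, sgn (f (x + y)) := by
    rw [Fintype.sum_prod_type, ← sum_fiberwise (s := univ) (g := M)]
    refine sum_congr rfl fun m _ => ?_
    simp only [mul_sum]
    rw [sum_comm]
    refine sum_congr rfl fun y _ => sum_congr rfl fun x hx => ?_
    rw [(mem_filter.mp hx).2, xorFunction, mul_comm]
  have hm : ∀ m, ∑ y, sgn (B m y) * ∑ x ∈ msgFiber M m, sgn (f (x + y)) ≤
      2 ^ n * (((msgFiber M m).card : ℝ) +
        smoothWeight c (msgFiber M m) / (msgFiber M m).card) / 2 := by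
    intro m
    calc ∑ y, sgn (B m y) * ∑ x ∈ msgFiber M m, sgn (f (x + y))
        ≤ ∑ y, (((msgFiber M m).card : ℝ) +
            (∑ x ∈ msgFiber M m, sgn (f (x + y))) ^ 2 / (msgFiber M m).card) / 2 := by
          refine sum_le_sum fun y _ => ?_
          refine (le_abs_self _).trans ?_
          rw [abs_mul, abs_sgn, one_mul]
          refine abs_le_add_sq_div ((abs_sum_le_sum_abs _ _).trans ?_)
          simp [abs_sgn]
      _ = _ := by
          rw [← sum_div, sum_add_distrib, ← sum_div,
            sum_sq_sum_translate (F := fun x => sgn (f x)) hF]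
          simp only [sum_const, card_univ, card_cube, nsmul_eq_mul, smoothWeight]
          push_cast
          ring
  have hsum : ∑ p : Cube n × Cube n, sgn (xorFunction f p.1 p.2) * sgn (B (M p.1) p.2) ≤
      2 ^ n * (2 ^ n + ∑ m, smoothWeight c (msgFiber M m) / (msgFiber M m).card) / 2 := by
    rw [hcorr]
    refine (sum_le_sum fun m _ => hm m).trans (le_of_eq ?_)
    rw [← sum_card_msgFiber M, ← sum_div, ← mul_sum, sum_add_distrib]
  rw [uniformProb_eq, Fintype.card_prod, card_cube]
  push_cast
  have : (∑ p : Cube n × Cube n, sgn (xorFunction f p.1 p.2) * sgn (B (M p.1) p.2)) /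
      (2 * (2 ^ n * 2 ^ n)) ≤ (2 ^ n * (2 ^ n +
        ∑ m, smoothWeight c (msgFiber M m) / (msgFiber M m).card) / 2) /
          (2 * (2 ^ n * 2 ^ n)) := by gcongr
  refine (add_le_add_right this (1 / 2)).trans (le_of_eq ?_)
  field_simp
  ring

/-- Bound for the smoothed weight from a uniform bound on the Fourier coefficients. -/
lemma smoothWeight_div_le_of_coeff {c : Cube n → ℝ} (h0 : c 0 = 0) {b : ℝ}
    (hc : ∀ S, c S ^ 2 ≤ b) (X : Finset (Cube n)) :
    smoothWeight c X / X.card ≤ b * (2 ^ n - X.card) := by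
  have hb : 0 ≤ b := (sq_nonneg _).trans (hc 0)
  have hX : (X.card : ℝ) ≤ 2 ^ n := by
    have := card_le_univ X
    rw [card_cube] at this
    exact_mod_cast this
  have h : smoothWeight c X ≤ b * (2 ^ n * X.card - X.card ^ 2) := by
    have hle : smoothWeight c X ≤
        ∑ S, (b * charSum X S ^ 2 - if S = 0 then b * charSum X S ^ 2 else 0) := by
      refine sum_le_sum fun S _ => ?_
      split_ifs with hS
      · simp [hS, h0]
      · rw [sub_zero]
        exact mul_le_mul_of_nonneg_right (hc S) (sq_nonneg _)
    rw [sum_sub_distrib, ← mul_sum, sum_charSum_sq] at hle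
    simp only [sum_ite_eq', mem_univ, if_true, charSum_zero] at hle
    linarith
  rcases (Nat.cast_nonneg (α := ℝ) X.card).eq_or_lt with h1 | h1
  · rw [← h1]
    simpa using by positivity
  · rw [div_le_iff₀ h1]
    linarith

/-! ### Large spectrum of a fibre and its dimension -/

/-- The span of the large spectrum of `X`. -/
noncomputable def largeSpan (X : Finset (Cube n)) (ρ : ℝ) : Submodule (ZMod 2) (Cube n) :=
  Submodule.span (ZMod 2) {S | ρ * X.card < |charSum X S|}

lemma smoothWeight_le_largeSpan {c : Cube n → ℝ} (h1 : ∑ S, c S ^ 2 ≤ 1) {ρ : ℝ}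
    (X : Finset (Cube n)) :
    smoothWeight c X ≤
      X.card ^ 2 * (ρ ^ 2 + (1 - ρ ^ 2) * weight c (largeSpan X ρ)) := by
  classical
  have : smoothWeight c X ≤ ∑ S, (X.card : ℝ) ^ 2 *
      (ρ ^ 2 * c S ^ 2 + (1 - ρ ^ 2) * if S ∈ largeSpan X ρ then c S ^ 2 else 0) := by
    refine sum_le_sum fun S _ => ?_
    split_ifs with hS
    · have : charSum X S ^ 2 ≤ (X.card : ℝ) ^ 2 := by
        rw [← sq_abs]
        exact pow_le_pow_left₀ (abs_nonneg _) (abs_charSum_le X S) 2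
      have := mul_le_mul_of_nonneg_left this (sq_nonneg (c S))
      linarith
    · have h2 : |charSum X S| ≤ ρ * X.card := by
        by_contra h
        exact hS (Submodule.subset_span (not_le.mp h))
      have : charSum X S ^ 2 ≤ (ρ * X.card) ^ 2 := by
        rw [← sq_abs]
        exact pow_le_pow_left₀ (abs_nonneg _) h2 2
      have := mul_le_mul_of_nonneg_left this (sq_nonneg (c S))
      linarith
  refine this.trans ?_
  rw [← mul_sum, sum_add_distrib, ← mul_sum, ← mul_sum, ← weight_eq]
  gcongr
  nlinarith [sq_nonneg ρ]

/-- A set on which all the parities in a subspace of dimension `d` are constant has density at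
most `2⁻ᵈ`. -/
lemma card_mul_le_of_const {Y : Finset (Cube n)} {s : Set (Cube n)}
    (hs : ∀ S ∈ s, ∃ a, ∀ x ∈ Y, parity S x = a) :
    (Y.card : ℝ) * 2 ^ Module.finrank (ZMod 2) (Submodule.span (ZMod 2) s) ≤ 2 ^ n := by
  classical
  have hspan : ∀ S ∈ Submodule.span (ZMod 2) s, ∃ a, ∀ x ∈ Y, parity S x = a := by
    intro S hS
    induction hS using Submodule.span_induction with
    | mem S hS => exact hs S hS
    | zero => exact ⟨0, fun x _ => parity_zero_left x⟩
    | add S T _ _ h1 h2 =>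
      obtain ⟨a, ha⟩ := h1
      obtain ⟨b, hb⟩ := h2
      exact ⟨a + b, fun x hx => by rw [parity_add_left, ha x hx, hb x hx]⟩
    | smul r S _ h =>
      obtain ⟨a, ha⟩ := h
      rcases zmod_two_cases r with rfl | rfl
      · exact ⟨0, fun x _ => by simp⟩
      · exact ⟨a, fun x hx => by rw [one_smul, ha x hx]⟩
  have hsq : ∀ S ∈ Submodule.span (ZMod 2) s, charSum Y S ^ 2 = (Y.card : ℝ) ^ 2 := by
    intro S hS
    obtain ⟨a, ha⟩ := hspan S hS
    have : charSum Y S = Y.card * sgn a := by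
      rw [charSum, sum_congr rfl fun x hx => by rw [chi, ha x hx]]
      simp
    rw [this, mul_pow, sgn_sq, mul_one]
  have hcard : ((univ.filter fun S => S ∈ Submodule.span (ZMod 2) s).card : ℝ) =
      2 ^ Module.finrank (ZMod 2) (Submodule.span (ZMod 2) s) := by
    have := natCard_submodule (Submodule.span (ZMod 2) s)
    rw [Nat.card_eq_fintype_card, Fintype.card_subtype] at this
    exact_mod_cast this
  -- Parseval for the indicator of `Y`, keeping only the characters in the span.
  have h : (Y.card : ℝ) ^ 2 * 2 ^ Module.finrank (ZMod 2) (Submodule.span (ZMod 2) s) ≤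
      2 ^ n * Y.card := by
    rw [← sum_charSum_sq, ← hcard, mul_comm, ← nsmul_eq_mul, ← sum_const,
      ← sum_congr rfl fun S hS => hsq S (mem_filter.mp hS).2]
    exact sum_le_sum_of_subset_of_nonneg (filter_subset _ _) fun S _ _ => sq_nonneg _
  rcases (Nat.cast_nonneg (α := ℝ) Y.card).eq_or_lt with h1 | h1
  · rw [← h1]
    simp
  · refine le_of_mul_le_mul_left ?_ h1
    linarith

/-- The witness is the majority value of the parity on `X`, read off from the sign of the character
sum. -/
lemma exists_card_filter_parity_ne (X : Finset (Cube n)) (S : Cube n) :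
    ∃ a, ((X.filter fun x => parity S x ≠ a).card : ℝ) = (X.card - |charSum X S|) / 2 := by
  have h : ∀ a, ((X.filter fun x => parity S x ≠ a).card : ℝ) =
      (X.card - sgn a * charSum X S) / 2 := by
    intro a
    rw [card_filter]
    push_cast
    have : ∀ x, (if parity S x ≠ a then (1 : ℝ) else 0) = (1 - sgn a * chi S x) / 2 := by
      intro x
      have := ite_eq_sgn (parity S x) a
      rw [ite_not, chi]
      split_ifs at this ⊢ <;> linarith
    simp only [this, ← sum_div, sum_sub_distrib, ← mul_sum, charSum]
    simp
  rcases le_total 0 (charSum X S) with h0 | h0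
  · exact ⟨0, by rw [h, abs_of_nonneg h0, sgn_zero, one_mul]⟩
  · exact ⟨1, by rw [h, abs_of_nonpos h0, sgn_one, neg_one_mul]⟩

/-- A basis of large characters has at most `n` members, each constant on `X` off at most `|X| /
(2n)` points. By the union bound all are constant on at least half of `X`, which costs the factor 2;
this dictates the threshold `1 - 1/n`. -/
lemma card_mul_two_pow_largeSpan_le (hn : n ≠ 0) (X : Finset (Cube n)) :
    (X.card : ℝ) * 2 ^ Module.finrank (ZMod 2) (largeSpan X (1 - 1 / n)) ≤ 2 * 2 ^ n := by
  classical
  have hn' : (0 : ℝ) < n := by positivity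
  obtain ⟨b, hb, hspan, -⟩ := Submodule.exists_fun_fin_finrank_span_eq (ZMod 2)
    {S | (1 - 1 / (n : ℝ)) * X.card < |charSum X S|}
  choose a ha using fun i => exists_card_filter_parity_ne X (b i)
  let bad : Finset (Cube n) := univ.biUnion fun i => X.filter fun x => parity (b i) x ≠ a i
  have hbad : (bad.card : ℝ) ≤ X.card / 2 := by
    have h1 : (bad.card : ℝ) ≤
        ∑ i, ((X.filter fun x => parity (b i) x ≠ a i).card : ℝ) := by
      exact_mod_cast card_biUnion_le
    have h2 : ∀ i, ((X.filter fun x => parity (b i) x ≠ a i).card : ℝ) ≤ X.card / (2 * n) := by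
      intro i
      rw [ha]
      have h3 : (1 - 1 / (n : ℝ)) * X.card < |charSum X (b i)| := hb i
      have h4 : (X.card : ℝ) / (2 * n) = (X.card - (1 - 1 / (n : ℝ)) * X.card) / 2 := by
        field_simp
        ring
      rw [h4]
      linarith
    have h5 := h1.trans (sum_le_sum fun i _ => h2 i)
    rw [sum_const, card_univ, Fintype.card_fin, nsmul_eq_mul] at h5
    refine h5.trans ?_
    have h6 : (Module.finrank (ZMod 2) (Submodule.span (ZMod 2)
        {S | (1 - 1 / (n : ℝ)) * X.card < |charSum X S|}) : ℝ) ≤ n := by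
      have := Submodule.finrank_le (Submodule.span (ZMod 2)
        {S | (1 - 1 / (n : ℝ)) * X.card < |charSum X S|})
      rw [Module.finrank_fin_fun] at this
      exact_mod_cast this
    calc _ ≤ (n : ℝ) * (X.card / (2 * n)) := by gcongr
      _ = X.card / 2 := by field_simp
  have hgood : (X.card : ℝ) / 2 ≤ (X \ bad).card := by
    have : X.card ≤ (X \ bad).card + bad.card := by
      have := le_card_sdiff bad X
      omega
    have : (X.card : ℝ) ≤ (X \ bad).card + bad.card := by exact_mod_cast this
    linarith
  have h := card_mul_le_of_const (Y := X \ bad) (s := Set.range b) (by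
    rintro _ ⟨i, rfl⟩
    refine ⟨a i, fun x hx => ?_⟩
    by_contra hne
    obtain ⟨h1, h2⟩ := mem_sdiff.mp hx
    exact h2 (mem_biUnion.mpr ⟨i, mem_univ i, mem_filter.mpr ⟨h1, hne⟩⟩))
  rw [hspan] at h
  have := mul_le_mul_of_nonneg_right hgood
    (show (0 : ℝ) ≤ 2 ^ Module.finrank (ZMod 2) (largeSpan X (1 - 1 / n)) by positivity)
  have h' := this.trans h
  linarith

lemma sub_mul_log_two_le {d s : ℕ} : ((d : ℝ) - s) * Real.log 2 ≤ 2 ^ d / 2 ^ s - 1 := by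
  have := Real.add_one_le_exp (((d : ℝ) - s) * Real.log 2)
  rw [sub_mul, Real.exp_sub, Real.exp_nat_mul, Real.exp_nat_mul, Real.exp_log two_pos,
    ← sub_mul] at this
  linarith

/-- A partition into `2ᵗ` parts `m` of weights `a m` with `a m * 2 ^ d m ≤ 2 ∑ a` has
average `d` at most `t + 1`. -/
lemma sum_mul_le_of_mul_two_pow_le {μ : Type*} [Fintype μ] {t : ℕ} (hμ : Fintype.card μ = 2 ^ t)
    {a : μ → ℝ} (ha : ∀ m, 0 ≤ a m) {d : μ → ℕ} {N : ℝ} (hN : ∑ m, a m = N)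
    (h : ∀ m, a m * 2 ^ d m ≤ 2 * N) : ∑ m, a m * d m ≤ (t + 1) * N := by
  have hlog : 0 < Real.log 2 := Real.log_pos one_lt_two
  have h1 : ∀ m, (a m * d m - a m * (t + 1)) * Real.log 2 ≤ N / 2 ^ t - a m := by
    intro m
    -- Linearizing the exponential at `t + 1` makes the upper bounds sum to exactly zero over the `2
    -- ^ t` messages.
    have h2 := mul_le_mul_of_nonneg_left (sub_mul_log_two_le (d := d m) (s := t + 1)) (ha m)
    have h3 : a m * (2 ^ d m / 2 ^ (t + 1)) ≤ N / 2 ^ t := by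
      rw [← mul_div_assoc, div_le_div_iff₀ (by positivity) (by positivity), pow_succ]
      have := mul_le_mul_of_nonneg_right (h m) (show (0 : ℝ) ≤ 2 ^ t by positivity)
      linarith
    push_cast at h2
    linarith
  have h2 := sum_le_sum fun m (_ : m ∈ univ) => h1 m
  rw [← sum_mul, sum_sub_distrib, sum_sub_distrib, ← sum_mul, hN, sum_const, card_univ, hμ,
    nsmul_eq_mul] at h2
  push_cast at h2
  rw [mul_div_cancel₀ _ (by positivity), sub_self] at h2
  have := nonpos_of_mul_nonpos_left h2 hlog
  linarith

theorem uniformProb_protocol_le_of_weight {f : Cube n → ZMod 2} {c : Cube n → ℝ} (hn : n ≠ 0)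
    (hF : ∀ x, sgn (f x) = ∑ S, c S * chi S x)
    (hW : ∀ A : Submodule (ZMod 2) (Cube n), weight c A ≤ Module.finrank (ZMod 2) A / (n : ℝ))
    {t : ℕ} (M : Cube n → (Fin t → Bool)) (B : (Fin t → Bool) → Cube n → ZMod 2) :
    uniformProb (fun p : Cube n × Cube n => xorFunction f p.1 p.2 = B (M p.1) p.2) ≤
      1 - (1 - (1 - 1 / (n : ℝ)) ^ 2) * (1 - (t + 1) / n) / 4 := by
  have hn' : (0 : ℝ) < n := by positivity
  have hn1 : (1 : ℝ) ≤ n := by exact_mod_cast Nat.one_le_iff_ne_zero.mpr hn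
  have h1n : 1 / (n : ℝ) ≤ 1 := (div_le_one hn').mpr hn1
  have h1n0 : 0 < 1 / (n : ℝ) := by positivity
  set ρ : ℝ := 1 - 1 / n with hρ
  have hρ0 : 0 ≤ ρ := by linarith
  have hρ1 : ρ ≤ 1 := by linarith
  have hρ2 : 0 ≤ 1 - ρ ^ 2 := by nlinarith
  have hc1 : ∑ S, c S ^ 2 ≤ 1 := by
    rw [← weight_top]
    refine (hW ⊤).trans (le_of_eq ?_)
    rw [finrank_top, Module.finrank_fin_fun]
    exact div_self hn'.ne'
  let a : (Fin t → Bool) → ℝ := fun m => (msgFiber M m).card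
  let d : (Fin t → Bool) → ℕ := fun m => Module.finrank (ZMod 2) (largeSpan (msgFiber M m) ρ)
  have ha : ∀ m, 0 ≤ a m := fun m => Nat.cast_nonneg _
  have hsum : ∑ m, a m = 2 ^ n := sum_card_msgFiber M
  have hd : ∑ m, a m * d m ≤ (t + 1) * 2 ^ n :=
    sum_mul_le_of_mul_two_pow_le (by simp) ha hsum
      fun m => card_mul_two_pow_largeSpan_le hn (msgFiber M m)
  have hE : ∀ m, smoothWeight c (msgFiber M m) / a m ≤
      a m * ρ ^ 2 + (1 - ρ ^ 2) / n * (a m * d m) := by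
    intro m
    rcases (ha m).eq_or_lt with h0 | h0
    · rw [← h0]
      simp
    · rw [div_le_iff₀ h0]
      refine (smoothWeight_le_largeSpan hc1 (ρ := ρ) _).trans ?_
      have := mul_le_mul_of_nonneg_left (hW (largeSpan (msgFiber M m) ρ)) hρ2
      calc a m ^ 2 * (ρ ^ 2 + (1 - ρ ^ 2) * weight c (largeSpan (msgFiber M m) ρ))
          ≤ a m ^ 2 * (ρ ^ 2 + (1 - ρ ^ 2) * (d m / n)) := by gcongr
        _ = _ := by ring
  have hE2 : ∑ m, smoothWeight c (msgFiber M m) / a m ≤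
      2 ^ n * (ρ ^ 2 + (1 - ρ ^ 2) * ((t + 1) / n)) := by
    refine (sum_le_sum fun m _ => hE m).trans ?_
    rw [sum_add_distrib, ← sum_mul, ← mul_sum, hsum]
    have := mul_le_mul_of_nonneg_left hd (div_nonneg hρ2 hn'.le)
    calc _ ≤ 2 ^ n * ρ ^ 2 + (1 - ρ ^ 2) / n * ((t + 1) * 2 ^ n) := by linarith
      _ = _ := by ring
  refine (uniformProb_protocol_le hF M B).trans ?_
  have : (∑ m, smoothWeight c (msgFiber M m) / a m) / (4 * 2 ^ n) ≤
      (ρ ^ 2 + (1 - ρ ^ 2) * ((t + 1) / n)) / 4 := by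
    rw [div_le_div_iff₀ (by positivity) (by positivity)]
    linarith
  refine (add_le_add_right this (3 / 4)).trans (le_of_eq ?_)
  ring

theorem uniformProb_protocol_le_of_coeff {f : Cube n → ZMod 2} {c : Cube n → ℝ}
    (hF : ∀ x, sgn (f x) = ∑ S, c S * chi S x) (h0 : c 0 = 0) {b : ℝ} (hc : ∀ S, c S ^ 2 ≤ b)
    {t : ℕ} (M : Cube n → (Fin t → Bool)) (B : (Fin t → Bool) → Cube n → ZMod 2) :
    uniformProb (fun p : Cube n × Cube n => xorFunction f p.1 p.2 = B (M p.1) p.2) ≤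
      3 / 4 + b * (2 ^ t - 1) / 4 := by
  refine (uniformProb_protocol_le hF M B).trans ?_
  have h := sum_le_sum fun m (_ : m ∈ univ) => smoothWeight_div_le_of_coeff h0 hc (msgFiber M m)
  rw [← mul_sum, sum_sub_distrib, sum_card_msgFiber] at h
  simp only [sum_const, card_univ, Fintype.card_pi, Fintype.card_bool, prod_const,
    Fintype.card_fin, nsmul_eq_mul] at h
  push_cast at h
  gcongr 3 / 4 + ?_
  rw [div_le_div_iff₀ (by positivity) (by positivity)]
  linarith

lemma coeff_sq_le {c : Cube n → ℝ}
    (hW : ∀ A : Submodule (ZMod 2) (Cube n), weight c A ≤ Module.finrank (ZMod 2) A / (n : ℝ))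
    (S : Cube n) : c S ^ 2 ≤ 1 / n := by
  classical
  calc c S ^ 2 ≤ weight c (Submodule.span (ZMod 2) {S}) := by
        rw [weight_eq]
        refine le_trans ?_ (single_le_sum (f := fun T =>
          if T ∈ Submodule.span (ZMod 2) {S} then c T ^ 2 else 0)
          (fun T _ => by split_ifs <;> positivity) (mem_univ S))
        rw [if_pos (Submodule.mem_span_singleton_self S)]
    _ ≤ _ := hW _
    _ ≤ 1 / n := by
        gcongr
        exact_mod_cast finrank_span_le_card (R := ZMod 2) {S}

lemma uniformProb_le_one {α : Type} [Fintype α] (p : α → Prop) [DecidablePred p] :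
    uniformProb p ≤ 1 :=
  div_le_one_of_le₀ (by exact_mod_cast card_le_univ _) (Nat.cast_nonneg _)

end F2Sketch

/-! ### The two lower bounds -/

theorem mainTheorem4 (k n : ℕ) (hk : 1 ≤ k) (hn : n = 3 ^ k)
    (ε γ : ℝ) (hε : ε ∈ Set.Icc (0 : ℝ) 1) (hγ : γ < 1 / 2 - ε) :
    ((⌊ε ^ 2 * (n : ℝ)⌋₊ + 1 : ℕ) : ℕ∞) ≤
        F2Sketch.uniformSketchComplexity (F2Sketch.recMaj k) γ ∧
    ENNReal.ofReal (ε ^ 2 * (n : ℝ) + 1) ≤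
        ((F2Sketch.uniformOneWayComplexity (F2Sketch.xorFunction (F2Sketch.recMaj k))
          ((1 / (n : ℝ)) * (1 / 4 - ε ^ 2)) : ℕ∞) : ENNReal) := by
  obtain ⟨c, h0, hF, hW⟩ := F2Sketch.exists_recMaj_spectrum k
  have hcast : ((3 ^ k : ℕ) : ℝ) = 3 ^ k := by push_cast; rfl
  simp only [← hcast] at hW
  subst hn
  have hn0 : (3 ^ k : ℕ) ≠ 0 := by positivity
  have hnpos : (0 : ℝ) < (3 ^ k : ℕ) := by positivity
  constructor
  · refine le_iInf₂ fun d hd => ?_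
    obtain ⟨α, g, hα⟩ := hd
    by_contra hlt
    have hlt : d < ⌊ε ^ 2 * ((3 ^ k : ℕ) : ℝ)⌋₊ + 1 := by exact_mod_cast not_le.mp hlt
    have hd : (d : ℝ) ≤ ε ^ 2 * ((3 ^ k : ℕ) : ℝ) :=
      (Nat.le_floor_iff (by positivity)).mp (Nat.lt_succ_iff.mp hlt)
    have hw : F2Sketch.weight c (Submodule.span (ZMod 2) (Set.range α)) ≤ ε ^ 2 := by
      refine (hW _).trans ((div_le_iff₀ hnpos).mpr (le_trans ?_ hd))
      exact_mod_cast F2Sketch.finrank_span_range_le α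
    have := F2Sketch.uniformProb_sketch_le hF α g hε.1 hw
    linarith [hε.1]
  · have key : ∀ t, F2Sketch.HasUniformOneWayProtocol
        (F2Sketch.xorFunction (F2Sketch.recMaj k))
        ((1 / ((3 ^ k : ℕ) : ℝ)) * (1 / 4 - ε ^ 2)) t → ε ^ 2 * ((3 ^ k : ℕ) : ℝ) + 1 ≤ t := by
      rintro t ⟨M, B, hMB⟩
      by_contra hlt
      have hlt := not_le.mp hlt
      -- For `n = 3`: if `t ≤ 1`, success is at most `5/6`, below the required `11/12 + ε²/3`; if `t
      -- ≥ 2`, the assumed upper bound on `t` gives `ε² > 1/3`, so the required probability exceeds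
      -- 1.
      rcases hk.eq_or_lt with rfl | hk
      · rcases le_or_gt t 1 with ht | ht
        · have hprob := F2Sketch.uniformProb_protocol_le_of_coeff hF h0
            (F2Sketch.coeff_sq_le hW) M B
          have hpow : (2 : ℝ) ^ t ≤ 2 ^ 1 := pow_le_pow_right₀ one_le_two ht
          norm_num at hprob hMB hpow
          linarith [sq_nonneg ε]
        · have hprob := F2Sketch.uniformProb_le_one (fun p : F2Sketch.Cube (3 ^ 1) ×
            F2Sketch.Cube (3 ^ 1) => F2Sketch.xorFunction (F2Sketch.recMaj 1) p.1 p.2 =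
              B (M p.1) p.2)
          have ht : (2 : ℝ) ≤ t := by exact_mod_cast ht
          norm_num at hMB hlt hprob
          linarith
      · have hprob := hMB.trans (F2Sketch.uniformProb_protocol_le_of_weight hn0 hF hW M B)
        have h9 : (9 : ℝ) ≤ (3 ^ k : ℕ) := by
          exact_mod_cast Nat.pow_le_pow_right (n := 3) (by norm_num) hk
        generalize ((3 ^ k : ℕ) : ℝ) = N at hprob h9 hlt hnpos
        have hx : 1 / N ≤ 1 / 9 := one_div_le_one_div_of_le (by norm_num) h9
        have hx0 : 0 < 1 / N := by positivity
        have ht : (t + 1) / N < ε ^ 2 + 2 * (1 / N) := by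
          rw [div_lt_iff₀ hnpos, add_mul, mul_assoc, one_div_mul_cancel hnpos.ne']
          linarith
        generalize 1 / N = x at hprob hx hx0 ht
        have h1 : (2 - x) * (1 - (t + 1) / N) ≤ 1 - 4 * ε ^ 2 := by
          refine le_of_mul_le_mul_left ?_ hx0
          linarith
        have h2 : (2 - x) * (1 - ε ^ 2 - 2 * x) ≤ (2 - x) * (1 - (t + 1) / N) :=
          mul_le_mul_of_nonneg_left (by linarith) (by linarith)
        -- Combining `h1` and `h2` gives `1 + 2ε² - 5x + xε² + 2x² ≤ 0`, impossible for `x ≤ 1/9`;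
        -- at `x = 1/3` it could hold.
        nlinarith [sq_nonneg ε, mul_nonneg hx0.le (sq_nonneg ε)]
    have hD : ((⌈ε ^ 2 * ((3 ^ k : ℕ) : ℝ) + 1⌉₊ : ℕ) : ℕ∞) ≤
        F2Sketch.uniformOneWayComplexity (F2Sketch.xorFunction (F2Sketch.recMaj k))
          ((1 / ((3 ^ k : ℕ) : ℝ)) * (1 / 4 - ε ^ 2)) :=
      le_iInf₂ fun t ht => by exact_mod_cast Nat.ceil_le.mpr (key t ht)
    refine (ENNReal.ofReal_le_ofReal (Nat.le_ceil _)).trans ?_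
    rw [ENNReal.ofReal_natCast, ← ENat.toENNReal_coe]
    exact ENat.toENNReal_mono hD
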